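/- All graphs are finite and simple. For a vertex $v$ of a graph $G$ let $N[v]$ be the set consisting of $v$ and its neighbours; an identifying code of $G$ is a set $\mathcal C\subseteq V(G)$ such that the sets $N[v]\cap\mathcal C$ ($v\in V(G)$) are nonempty and pairwise distinct. For an edge $e$ of $G$ let $N[e]$ be the set consisting of $e$ and the edges sharing an endpoint with $e$; an edge-identifying code of $G$ is a set $\mathcal C_E\subseteq E(G)$ such that the sets $N[e]\cap\mathcal C_E$ ($e\in E(G)$) are nonempty and pairwise distinct. **Theorem 5.6 (4-approximation).** 1. There is a polynomial-time algorithm that, given a graph $G$, decides whether $G$ has an edge-identifying code and, if so, outputs an edge-identifying code of $G$ whose size is at most $4$ times the minimum size of an edge-identifying code of $G$. 2. There is a polynomial-time algorithm that, given a graph $G$ that is the line graph of some graph, decides whether $G$ has an identifying code and, if so, outputs an identifying code of $G$ whose size is at most $4$ times the minimum size of an identifying code of $G$. 3. Let $G$ be a graph with at least one edge, and let $\mathcal C_E$ be an inclusionwise minimal edge-identifying code of $G$. Then $|\mathcal C_E|\le 2|V(G)|-3$, and if $G$ has no isolated vertex, then $|\mathcal C_E|\ge |V(G)|/2$. Here the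 algorithms run on a unit-cost random access machine with addition and truncated subtraction, the input is the adjacency matrix of the graph, and the number of steps is bounded by a polynomial in the number of its vertices. -/

import Mathlib

/-! ### Identifying codes and edge-identifying codes -/

/-- The closed neighbourhood `N[v]`. -/
def closedNbhd {V : Type*} (G : SimpleGraph V) (v : V) : Set V :=
  {w | w = v ∨ G.Adj v w}

/-- `C` is an identifying code of `G`: a dominating and separating set of vertices. -/
def IsIdentifyingCode {V : Type*} (G : SimpleGraph V) (C : Set V) : Prop :=
  (∀ v, (closedNbhd G v ∩ C).Nonempty) ∧
  (∀ u v, u ≠ v → closedNbhd G u ∩ C ≠ closedNbhd G v ∩ C)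

/-- For an edge `e`, the set `N[e]`: the edge `e` together with the edges adjacent to it, that is,
sharing an endpoint with it. -/
def closedEdgeNbhd {V : Type*} (G : SimpleGraph V) (e : Sym2 V) : Set (Sym2 V) :=
  {f | f ∈ G.edgeSet ∧ (f = e ∨ ∃ v, v ∈ e ∧ v ∈ f)}

/-- `C` is an edge-identifying code of `G`: an edge-dominating and edge-separating set of edges. -/
def IsEdgeIdentifyingCode {V : Type*} (G : SimpleGraph V) (C : Set (Sym2 V)) : Prop :=
  C ⊆ G.edgeSet ∧
  (∀ e ∈ G.edgeSet, (closedEdgeNbhd G e ∩ C).Nonempty) ∧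
  (∀ e ∈ G.edgeSet, ∀ f ∈ G.edgeSet, e ≠ f →
    closedEdgeNbhd G e ∩ C ≠ closedEdgeNbhd G f ∩ C)

/-- `G` is (isomorphic to) the line graph of a finite simple graph. -/
def IsLineGraph {n : ℕ} (G : SimpleGraph (Fin n)) : Prop :=
  ∃ (m : ℕ) (H : SimpleGraph (Fin m)), Nonempty (G ≃g H.lineGraph)

/-! ### A random access machine with a step count

Programs for a unit-cost random access machine with registers `0, 1, 2, …` and memory banks
`0, 1, 2, …`, each bank being an array of natural numbers that is addressed indirectly. A program is
a finite object, hence mentions only finitely many registers and banks. The only arithmetic is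
addition and truncated subtraction: one step lengthens the largest stored number by at most one bit,
so that polynomial time here is the same as polynomial time on a Turing machine. -/

/-- The memory of the machine. -/
structure RAMState where
  reg : ℕ → ℕ
  bank : ℕ → ℕ → ℕ

/-- Assign the value `a` to register `x`. -/
def RAMState.setReg (s : RAMState) (x a : ℕ) : RAMState :=
  { s with reg := Function.update s.reg x a }

/-- Write the value `a` at address `i` of bank `b`. -/
def RAMState.setBank (s : RAMState) (b i a : ℕ) : RAMState :=
  { s with bank := Function.update s.bank b (Function.update (s.bank b) i a) }

/-- Programs. In the comments, `x, y, z` are registers and `b` is a memory bank. -/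
inductive RAMProg where
  /-- `x := c`, for a constant `c` of the program -/
  | const (x c : ℕ)
  /-- `x := y + z` -/
  | add (x y z : ℕ)
  /-- `x := max (y - z) 0` -/
  | sub (x y z : ℕ)
  /-- `x := b[y]` -/
  | load (x b y : ℕ)
  /-- `b[y] := x` -/
  | store (b y x : ℕ)
  /-- first `p`, then `q` -/
  | seq (p q : RAMProg)
  /-- if `x ≠ 0` then `p` else `q` -/
  | cond (x : ℕ) (p q : RAMProg)
  /-- while `x ≠ 0` do `p` -/
  | loop (x : ℕ) (p : RAMProg)

/-- `RAMExec P s t s'`: the program `P`, started in the state `s`, halts after exactly `t` steps in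
the state `s'`. Every assignment and every evaluation of a test is one step. -/
inductive RAMExec : RAMProg → RAMState → ℕ → RAMState → Prop where
  | const (x c : ℕ) (s : RAMState) :
      RAMExec (.const x c) s 1 (s.setReg x c)
  | add (x y z : ℕ) (s : RAMState) :
      RAMExec (.add x y z) s 1 (s.setReg x (s.reg y + s.reg z))
  | sub (x y z : ℕ) (s : RAMState) :
      RAMExec (.sub x y z) s 1 (s.setReg x (s.reg y - s.reg z))
  | load (x b y : ℕ) (s : RAMState) :
      RAMExec (.load x b y) s 1 (s.setReg x (s.bank b (s.reg y)))
  | store (b y x : ℕ) (s : RAMState) :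
      RAMExec (.store b y x) s 1 (s.setBank b (s.reg y) (s.reg x))
  | seq {p q : RAMProg} {s s₁ s₂ : RAMState} {t₁ t₂ : ℕ} :
      RAMExec p s t₁ s₁ → RAMExec q s₁ t₂ s₂ → RAMExec (.seq p q) s (t₁ + t₂) s₂
  | condTrue {x : ℕ} {p q : RAMProg} {s s₁ : RAMState} {t : ℕ} :
      s.reg x ≠ 0 → RAMExec p s t s₁ → RAMExec (.cond x p q) s (t + 1) s₁
  | condFalse {x : ℕ} {p q : RAMProg} {s s₁ : RAMState} {t : ℕ} :
      s.reg x = 0 → RAMExec q s t s₁ → RAMExec (.cond x p q) s (t + 1) s₁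
  | loopStop {x : ℕ} {p : RAMProg} {s : RAMState} :
      s.reg x = 0 → RAMExec (.loop x p) s 1 s
  | loopStep {x : ℕ} {p : RAMProg} {s s₁ s₂ : RAMState} {t₁ t₂ : ℕ} :
      s.reg x ≠ 0 → RAMExec p s t₁ s₁ → RAMExec (.loop x p) s₁ t₂ s₂ →
      RAMExec (.loop x p) s (t₁ + t₂ + 1) s₂

/-! ### Polynomial-time approximation of minimum-size subset problems on graphs -/

open Classical in
/-- The input of a graph with vertices `0, …, n - 1`: register `0` holds `n`, bank `0` holds the
adjacency matrix row by row, and everything else is `0`. -/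
noncomputable def graphInput {n : ℕ} (G : SimpleGraph (Fin n)) : RAMState where
  reg := fun x => if x = 0 then n else 0
  bank := fun b a =>
    if b = 0 ∧ ∃ i j : Fin n, a = (i : ℕ) * n + (j : ℕ) ∧ G.Adj i j then 1 else 0

/-- The set of vertices that the machine outputs: bank `1` holds its characteristic vector. -/
def outputVertices (n : ℕ) (s : RAMState) : Set (Fin n) :=
  {v | s.bank 1 v ≠ 0}

/-- The set of pairs of vertices that the machine outputs: bank `1` holds a matrix, row by row, with
a nonzero entry at `(i, j)` or at `(j, i)` for each pair `ij` in the set. -/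
def outputPairs (n : ℕ) (s : RAMState) : Set (Sym2 (Fin n)) :=
  {e | ∃ i j : Fin n, e = s(i, j) ∧ s.bank 1 ((i : ℕ) * n + (j : ℕ)) ≠ 0}

/-- Consider the minimization problem: given a graph `G` in the class `inst`, find a set of least
size among the sets `C` with `feas G C` (or report that there is none). It is approximable within
the factor `r` in polynomial time: there are one program and one polynomial such that the program
halts on every graph within a number of steps bounded by the polynomial in the number of vertices,
and on every graph of the class it reports correctly in register `0` whether a feasible set exists,
and if so outputs a feasible set whose size is at most `r` times that of any feasible set. -/
def ApproximableInPolyTime (r : ℕ) (inst : ∀ n : ℕ, SimpleGraph (Fin n) → Prop)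
    {S : ℕ → Type} (output : ∀ n : ℕ, RAMState → Set (S n))
    (feas : ∀ n : ℕ, SimpleGraph (Fin n) → Set (S n) → Prop) : Prop :=
  ∃ (P : RAMProg) (T : Polynomial ℕ), ∀ (n : ℕ) (G : SimpleGraph (Fin n)),
    ∃ (t : ℕ) (s : RAMState), RAMExec P (graphInput G) t s ∧ t ≤ T.eval n ∧
      (inst n G →
        (s.reg 0 ≠ 0 ↔ ∃ C, feas n G C) ∧
        (s.reg 0 ≠ 0 → feas n G (output n s) ∧
          ∀ C, feas n G C → (output n s).ncard ≤ r * C.ncard))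

/-! Both algorithms are greedy deletion: start from all edges (or vertices), run once through them,
and delete each one whose removal leaves a code. Codes are closed under supersets, so the outcome is
an inclusionwise minimal code unless the graph has no code at all, and it suffices to bound the
size of a minimal code by four times the size of an arbitrary one. For line graphs the algorithm
works on the given graph `G`; the root graph `H` with `G ≃ L(H)` occurs only in the analysis, where
identifying codes of `G` become edge-identifying codes of `H` (`isEdgeIdentifyingCode_image_iff`).

For edge-identifying codes the bound comes from comparison with the number `N` of non-isolated
vertices. A minimal code has at most `2N - 3` edges, because the graph formed by its edges is
2-degenerate (`exists_degree_le_two`, `ncard_add_three_le_of_degenerate`). Every code has at least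
`N / 2` edges (`support_ncard_le_two_mul`): at most one uncovered vertex is attached to each covered
vertex, and the covered vertices whose degree in the code is too small to pay for this are
compensated by their neighbours.

For the running time, a small structured language is compiled to the random access machine. Its
terms have addition, truncated subtraction, memory access and sums over all `i < n`; since a sum
serves as a bounded quantifier, being a code is expressed by a single term. All loops have exactly
`n` rounds, so the running time is bounded by a polynomial in `n` that is read off from the syntax
(`RAMTerm.compile_runs`, `RAMStmt.compile_runs`). -/

/-! ### Edge-identifying codes in terms of incidences -/

section Combinatorics

open Finset

variable {V : Type*} {G : SimpleGraph V}

/-- Two edges, given as unordered pairs, share an endpoint. Every edge meets itself. -/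
def Meets (e f : Sym2 V) : Prop := ∃ v, v ∈ e ∧ v ∈ f

theorem mem_closedEdgeNbhd_iff {e f : Sym2 V} :
    f ∈ closedEdgeNbhd G e ↔ f ∈ G.edgeSet ∧ Meets e f := by
  constructor
  · rintro ⟨h, rfl | h'⟩
    · exact ⟨h, _, f.out_fst_mem, f.out_fst_mem⟩
    · exact ⟨h, h'⟩
  · exact fun h => ⟨h.1, .inr h.2⟩

theorem isEdgeIdentifyingCode_iff {C : Set (Sym2 V)} :
    IsEdgeIdentifyingCode G C ↔ C ⊆ G.edgeSet ∧ (∀ e ∈ G.edgeSet, ∃ c ∈ C, Meets e c) ∧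
      ∀ e ∈ G.edgeSet, ∀ f ∈ G.edgeSet, e ≠ f → ∃ c ∈ C, ¬ (Meets e c ↔ Meets f c) := by
  unfold IsEdgeIdentifyingCode
  refine and_congr_right fun hC => and_congr ?_ ?_
  · refine forall₂_congr fun e _ => ⟨?_, ?_⟩
    · rintro ⟨c, hc, hcC⟩
      exact ⟨c, hcC, (mem_closedEdgeNbhd_iff.1 hc).2⟩
    · rintro ⟨c, hcC, hc⟩
      exact ⟨c, mem_closedEdgeNbhd_iff.2 ⟨hC hcC, hc⟩, hcC⟩
  · refine forall₂_congr fun e _ => forall₂_congr fun f _ => imp_congr_right fun _ => ?_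
    rw [Ne, Set.ext_iff, not_forall]
    refine exists_congr fun c => ?_
    simp only [Set.mem_inter_iff, mem_closedEdgeNbhd_iff]
    have := @hC c
    tauto

theorem IsEdgeIdentifyingCode.mono {C D : Set (Sym2 V)} (hC : IsEdgeIdentifyingCode G C)
    (hCD : C ⊆ D) (hD : D ⊆ G.edgeSet) : IsEdgeIdentifyingCode G D := by
  rw [isEdgeIdentifyingCode_iff] at hC ⊢
  refine ⟨hD, fun e he => ?_, fun e he f hf hef => ?_⟩
  · obtain ⟨c, hc, h⟩ := hC.2.1 e he
    exact ⟨c, hCD hc, h⟩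
  · obtain ⟨c, hc, h⟩ := hC.2.2 e he f hf hef
    exact ⟨c, hCD hc, h⟩

/-! ### The upper bound: minimal codes are 2-degenerate -/

open Classical in
/-- If all degrees in the subgraph that the code induces on `S` were at least `3`, then every edge
`s(u, v)` of this subgraph could be dropped from the code. Indeed, an edge `s(u, w)` and an edge `f`
avoiding `u` and `v` that are separated by `s(u, v)` only force the neighbours of `u` other than `v`
to be the ends of `f`, and an end of `f` other than `w` has no neighbours but `u` and `w`. -/
theorem exists_degree_le_two {C : Set (Sym2 V)} (hC : IsEdgeIdentifyingCode G C)
    (hmin : ∀ c ∈ C, ¬ IsEdgeIdentifyingCode G (C \ {c})) {S : Finset V} (hS : S.Nonempty) :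
    ∃ u ∈ S, #{t ∈ S | s(u, t) ∈ C} ≤ 2 := by
  by_contra! hdeg
  obtain ⟨u₀, hu₀⟩ := hS
  obtain ⟨v₀, hv₀⟩ : (({t ∈ S | s(u₀, t) ∈ C} : Finset V)).Nonempty :=
    card_pos.1 (by have := hdeg u₀ hu₀; omega)
  rw [mem_filter] at hv₀
  have hc₀S : ∀ u ∈ s(u₀, v₀), u ∈ S := by
    intro u hu
    rcases Sym2.mem_iff.1 hu with rfl | rfl
    exacts [hu₀, hv₀.1]
  have hc₀ := hv₀.2
  have hm := hmin _ hc₀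
  generalize s(u₀, v₀) = c₀ at hc₀ hc₀S hm
  rw [isEdgeIdentifyingCode_iff] at hC hm
  obtain ⟨hCE, hdom, hsep⟩ := hC
  by_cases hd : ∀ e ∈ G.edgeSet, ∃ c ∈ C \ {c₀}, Meets e c
  · have hs : ∃ e ∈ G.edgeSet, ∃ f ∈ G.edgeSet,
        (Meets e c₀ ∧ ¬ Meets f c₀) ∧ ∀ c ∈ C, c ≠ c₀ → (Meets e c ↔ Meets f c) := by
      by_contra! hs
      refine hm ⟨Set.sdiff_subset.trans hCE, hd, fun e he f hf hef => ?_⟩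
      obtain ⟨c, hc, hcs⟩ := hsep e he f hf hef
      by_cases hcc : c = c₀
      · subst hcc
        by_cases h1 : Meets e c
        · obtain ⟨c', h2, h3, h4⟩ := hs e he f hf ⟨h1, by tauto⟩
          exact ⟨c', ⟨h2, h3⟩, by tauto⟩
        · obtain ⟨c', h2, h3, h4⟩ := hs f hf e he ⟨by tauto, h1⟩
          exact ⟨c', ⟨h2, h3⟩, by tauto⟩
      · exact ⟨c, ⟨hc, hcc⟩, hcs⟩
    obtain ⟨e, he, f, hf, ⟨⟨u, hue, huc⟩, hfc⟩, hns⟩ := hs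
    obtain ⟨v, rfl⟩ := Sym2.mem_iff_exists.1 huc
    obtain ⟨w, rfl⟩ := Sym2.mem_iff_exists.1 hue
    have huf : u ∉ f := fun h => hfc ⟨u, h, by simp⟩
    have hnb : ∀ t, s(u, t) ∈ C → t = v ∨ t ∈ f := by
      intro t ht
      by_cases htv : t = v
      · exact .inl htv
      have hne : s(u, t) ≠ s(u, v) := by simpa only [ne_eq, Sym2.congr_right] using htv
      obtain ⟨z, hz, hz'⟩ := (hns _ ht hne).1 ⟨u, by simp, by simp⟩
      rcases Sym2.mem_iff.1 hz' with rfl | rfl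
      · exact absurd hz huf
      · exact .inr hz
    induction f with | _ a b =>
    have hab : a ≠ b := G.ne_of_adj hf
    have hsub : ({t ∈ S | s(u, t) ∈ C} : Finset V) ⊆ {v, a, b} := by
      intro t ht
      have := hnb t (mem_filter.1 ht).2
      simpa using this
    have heq := eq_of_subset_of_card_le hsub (card_le_three.trans (hdeg u (hc₀S u (by simp))))
    have hfS : ∀ y ∈ s(a, b), y ∈ S := by
      intro y hy
      have hy' : y ∈ ({v, a, b} : Finset V) := by
        rcases Sym2.mem_iff.1 hy with rfl | rfl <;> simp
      rw [← heq] at hy'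
      exact (mem_filter.1 hy').1
    obtain ⟨y, hy, hyw⟩ : ∃ y ∈ s(a, b), y ≠ w := by
      by_cases haw : a = w
      · exact ⟨b, by simp, fun h => hab (haw.trans h.symm)⟩
      · exact ⟨a, by simp, haw⟩
    have hsub' : ({t ∈ S | s(y, t) ∈ C} : Finset V) ⊆ {u, w} := by
      intro t ht
      have ht' := (mem_filter.1 ht).2
      have hne : s(y, t) ≠ s(u, v) := fun h => hfc ⟨y, hy, by rw [← h]; simp⟩
      obtain ⟨z, hz, hz'⟩ := (hns _ ht' hne).2 ⟨y, hy, by simp⟩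
      rcases Sym2.mem_iff.1 hz' with rfl | rfl
      · rcases Sym2.mem_iff.1 hz with rfl | rfl
        · exact absurd hy huf
        · exact absurd rfl hyw
      · simpa using hz
    have h1 := card_le_card hsub'
    have h2 := card_le_two (a := u) (b := w)
    have h3 := hdeg y (hfS y hy)
    omega
  · push Not at hd
    obtain ⟨e, he, hd⟩ := hd
    obtain ⟨c, hc, u, hue, huc⟩ := hdom e he
    have hcc : c = c₀ := by
      by_contra hcc
      exact hd c ⟨hc, hcc⟩ ⟨u, hue, huc⟩
    subst hcc
    obtain ⟨v, rfl⟩ := Sym2.mem_iff_exists.1 huc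
    have hsub : ({t ∈ S | s(u, t) ∈ C} : Finset V) ⊆ {v} := by
      intro t ht
      by_contra htv
      have hne : s(u, t) ≠ s(u, v) := fun h => htv (mem_singleton.2 (Sym2.congr_right.1 h))
      exact hd s(u, t) ⟨(mem_filter.1 ht).2, hne⟩ ⟨u, hue, by simp⟩
    have h1 := card_le_card hsub
    have h2 := hdeg u (hc₀S u (by simp))
    rw [card_singleton] at h1
    omega

open Classical in
/-- A 2-degenerate graph on `k ≥ 2` vertices has at most `2k - 3` edges. -/
theorem ncard_add_three_le_of_degenerate [Finite V] {C : Set (Sym2 V)}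
    (hloop : ∀ v, s(v, v) ∉ C)
    (hdeg : ∀ S : Finset V, S.Nonempty → ∃ u ∈ S, #{t ∈ S | s(u, t) ∈ C} ≤ 2) :
    ∀ (k : ℕ) (S : Finset V), #S = k + 2 →
      {c ∈ C | ∀ v ∈ c, v ∈ S}.ncard + 3 ≤ 2 * #S := by
  intro k
  induction k with
  | zero =>
    intro S hS
    obtain ⟨a, b, hab, rfl⟩ := card_eq_two.1 hS
    have : {c ∈ C | ∀ v ∈ c, v ∈ ({a, b} : Finset V)} ⊆ {s(a, b)} := by
      rintro c ⟨hc, hcS⟩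
      induction c with | _ x y =>
      have hx := hcS x (by simp)
      have hy := hcS y (by simp)
      have hxy : x ≠ y := by rintro rfl; exact hloop x hc
      simp only [mem_insert, mem_singleton] at hx hy
      simp only [Set.mem_singleton_iff, Sym2.eq_iff]
      grind
    have := Set.ncard_le_ncard this
    rw [Set.ncard_singleton] at this
    omega
  | succ k ih =>
    intro S hS
    obtain ⟨u, hu, hd⟩ := hdeg S (card_pos.1 (by omega))
    have hcard : #(S.erase u) = k + 2 := by rw [card_erase_of_mem hu]; omega
    have h1 := ih _ hcard
    have h2 : {c ∈ C | ∀ v ∈ c, v ∈ S} ⊆ {c ∈ C | ∀ v ∈ c, v ∈ S.erase u} ∪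
        (fun t => s(u, t)) '' (({t ∈ S | s(u, t) ∈ C} : Finset V) : Set V) := by
      rintro c ⟨hc, hcS⟩
      by_cases huc : u ∈ c
      · obtain ⟨t, rfl⟩ := Sym2.mem_iff_exists.1 huc
        exact .inr ⟨t, by simpa using ⟨hcS t (by simp), hc⟩, rfl⟩
      · refine .inl ⟨hc, fun v hv => mem_erase.2 ⟨?_, hcS v hv⟩⟩
        rintro rfl
        exact huc hv
    have h3 := (Set.ncard_le_ncard h2).trans (Set.ncard_union_le _ _)
    have h4 := Set.ncard_image_le (f := fun t => s(u, t))
      (({t ∈ S | s(u, t) ∈ C} : Finset V).finite_toSet)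
    rw [Set.ncard_coe_finset] at h4
    omega

theorem ncard_add_three_le_of_minimal [Finite V] {C : Set (Sym2 V)}
    (hE : G.edgeSet.Nonempty) (hC : IsEdgeIdentifyingCode G C)
    (hmin : ∀ c ∈ C, ¬ IsEdgeIdentifyingCode G (C \ {c})) :
    C.ncard + 3 ≤ 2 * G.support.ncard := by
  classical
  have := Fintype.ofFinite V
  have hsupp : ∀ c ∈ G.edgeSet, ∀ v ∈ c, v ∈ G.support := by
    intro c hc v hv
    obtain ⟨w, rfl⟩ := Sym2.mem_iff_exists.1 hv
    exact ⟨w, hc⟩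
  have hcard : 2 ≤ #G.support.toFinset := by
    obtain ⟨e, he⟩ := hE
    induction e with | _ a b =>
    have hab : ({a, b} : Finset V) ⊆ G.support.toFinset := by
      intro v hv
      rw [Set.mem_toFinset]
      exact hsupp _ he v (by simpa using hv)
    simpa [card_pair (G.ne_of_adj he)] using card_le_card hab
  have h := ncard_add_three_le_of_degenerate (C := C)
    (fun v hv => G.loopless.irrefl v (hC.1 hv))
    (fun S hS => exists_degree_le_two hC hmin hS) (#G.support.toFinset - 2) G.support.toFinset
    (by omega)
  rw [Set.ncard_eq_toFinset_card' G.support]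
  convert h using 3
  ext c
  simp only [Set.mem_toFinset, Set.mem_ofPred_eq]
  exact ⟨fun hc => ⟨hc, hsupp c (hC.1 hc)⟩, And.left⟩

/-! ### The lower bound: half of the non-isolated vertices -/

/-- In an edge-identifying code, at most one edge `e` has the edges of the code at a given vertex as
its trace. -/
theorem IsEdgeIdentifyingCode.eq_of_trace {C : Set (Sym2 V)} (hC : IsEdgeIdentifyingCode G C)
    {x : V} {e f : Sym2 V} (he : e ∈ G.edgeSet) (hf : f ∈ G.edgeSet)
    (hex : ∀ c ∈ C, Meets e c ↔ x ∈ c) (hfx : ∀ c ∈ C, Meets f c ↔ x ∈ c) : e = f := by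
  by_contra hef
  obtain ⟨c, hc, h⟩ := (isEdgeIdentifyingCode_iff.1 hC).2.2 e he f hf hef
  exact h ((hex c hc).trans (hfx c hc).symm)

/-- A code has at least half as many edges as there are non-isolated vertices. Every non-isolated
vertex that is not covered by the code has a covered neighbour `x`, and distinct such vertices have
distinct such neighbours; call `x` *attached*. So it suffices to have the number of covered vertices
plus the number of attached vertices at most the sum of the degrees in the code. The only covered vertices that contribute more to the left than to the right side are
the attached vertices of degree one. The unique neighbour of such a vertex is not attached, has
degree at least two, and is the neighbour of no other vertex of degree one, so it makes up for the
deficit. -/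
theorem support_ncard_le_two_mul [Finite V] {C : Set (Sym2 V)}
    (hC : IsEdgeIdentifyingCode G C) : G.support.ncard ≤ 2 * C.ncard := by
  classical
  have := Fintype.ofFinite V
  obtain ⟨hCE, hdom, -⟩ := isEdgeIdentifyingCode_iff.1 hC
  obtain ⟨F, hF⟩ : ∃ F : SimpleGraph V, ∀ x y, F.Adj x y ↔ s(x, y) ∈ C := by
    refine ⟨SimpleGraph.fromEdgeSet C, fun x y => ?_⟩
    rw [SimpleGraph.fromEdgeSet_adj]
    exact ⟨And.left, fun h => ⟨h, G.ne_of_adj (hCE h)⟩⟩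
  have hFE : F.edgeSet = C := by
    ext c
    induction c with | _ x y =>
    exact hF x y
  -- the covered vertices
  let K : Finset V := {x | ∃ y, F.Adj x y}
  have hK : ∀ x, x ∈ K ↔ ∃ y, F.Adj x y := by simp [K]
  have hKc : ∀ c ∈ C, ∀ x ∈ c, x ∈ K := by
    intro c hc x hx
    obtain ⟨y, rfl⟩ := Sym2.mem_iff_exists.1 hx
    exact (hK x).2 ⟨y, (hF x y).2 hc⟩
  have hdegpos : ∀ x ∈ K, 1 ≤ F.degree x := fun x hx =>
    (F.degree_pos_iff_exists_adj x).2 ((hK x).1 hx)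
  have trace_out : ∀ x y, y ∉ K → ∀ c ∈ C, Meets s(x, y) c ↔ x ∈ c := by
    intro x y hy c hc
    constructor
    · rintro ⟨z, hz, hzc⟩
      rcases Sym2.mem_iff.1 hz with rfl | rfl
      · exact hzc
      · exact absurd (hKc c hc _ hzc) hy
    · exact fun h => ⟨x, by simp, h⟩
  have trace_leaf : ∀ x p, F.Adj x p → F.degree x = 1 → ∀ c ∈ C, Meets s(p, x) c ↔ p ∈ c := by
    intro x p hxp hd c hc
    constructor
    · rintro ⟨z, hz, hzc⟩
      rcases Sym2.mem_iff.1 hz with rfl | rfl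
      · exact hzc
      · obtain ⟨t, rfl⟩ := Sym2.mem_iff_exists.1 hzc
        obtain ⟨q, hq⟩ := card_eq_one.1 hd
        have h1 : t ∈ F.neighborFinset z := by simpa using (hF z t).2 hc
        have h2 : p ∈ F.neighborFinset z := by simpa using hxp
        rw [hq, mem_singleton] at h1 h2
        simp [h1, h2]
    · exact fun h => ⟨p, by simp, h⟩
  -- the attached vertices
  let O : Finset V := {x ∈ K | ∃ y ∉ K, G.Adj x y}
  let B : Finset V := {x ∈ O | F.degree x = 1}
  have hOK : O ⊆ K := filter_subset _ _
  have hBO : B ⊆ O := filter_subset _ _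
  have hOut : #(G.support.toFinset \ K) ≤ #O := by
    have hex : ∀ y ∈ G.support.toFinset \ K, ∃ x, G.Adj x y ∧ x ∈ O := by
      intro y hy
      rw [mem_sdiff, Set.mem_toFinset] at hy
      obtain ⟨⟨x, hyx⟩, hyK⟩ := hy
      obtain ⟨c, hc, hcm⟩ := hdom s(x, y) hyx.symm
      have hxK := hKc c hc x ((trace_out x y hyK c hc).1 hcm)
      exact ⟨x, hyx.symm, mem_filter.2 ⟨hxK, y, hyK, hyx.symm⟩⟩
    choose! g hg using hex
    refine card_le_card_of_injOn g (fun y hy => (hg y hy).2) ?_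
    intro y hy y' hy' hgy
    have h1 := hg y hy
    have h2 := hg y' hy'
    rw [← hgy] at h2
    have := hC.eq_of_trace (e := s(g y, y)) (f := s(g y, y')) h1.1 h2.1
      (trace_out _ _ (mem_sdiff.1 hy).2) (trace_out _ _ (mem_sdiff.1 hy').2)
    exact Sym2.congr_right.1 this
  have hpar : ∀ x ∈ B, ∃ p, F.Adj x p := fun x hx => (hK x).1 (hOK (hBO hx))
  choose! p hp using hpar
  have hpinj : Set.InjOn p B := by
    intro x hx x' hx' hpx
    have h1 := hp x hx
    have h2 := hp x' hx'
    rw [← hpx] at h2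
    have := hC.eq_of_trace (e := s(p x, x)) (f := s(p x, x')) (hCE ((hF _ _).1 h1.symm))
      (hCE ((hF _ _).1 h2.symm)) (trace_leaf _ _ h1 (mem_filter.1 hx).2)
      (trace_leaf _ _ h2 (mem_filter.1 hx').2)
    exact Sym2.congr_right.1 this
  have hpO : ∀ x ∈ B, p x ∉ O := by
    intro x hx hpx
    obtain ⟨-, y, hy, hadj⟩ := mem_filter.1 hpx
    have h1 := hp x hx
    have := hC.eq_of_trace (e := s(p x, x)) (f := s(p x, y)) (hCE ((hF _ _).1 h1.symm)) hadj
      (trace_leaf _ _ h1 (mem_filter.1 hx).2) (trace_out _ _ hy)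
    obtain rfl : x = y := Sym2.congr_right.1 this
    exact hy (hOK (hBO hx))
  have hpd : ∀ x ∈ B, 2 ≤ F.degree (p x) := by
    intro x hx
    have h1 := hp x hx
    by_contra! hlt
    have hd : F.degree (p x) = 1 := by
      have := hdegpos (p x) ((hK _).2 ⟨x, h1.symm⟩)
      omega
    obtain ⟨-, y, hy, hadj⟩ := mem_filter.1 (hBO hx)
    have := hC.eq_of_trace (e := s(x, p x)) (f := s(x, y)) (hCE ((hF _ _).1 h1)) hadj
      (trace_leaf _ _ h1.symm hd) (trace_out _ _ hy)
    obtain rfl : p x = y := Sym2.congr_right.1 this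
    exact hy ((hK _).2 ⟨x, h1.symm⟩)
  have hpK : B.image p ⊆ K := by
    intro q hq
    obtain ⟨x, hx, rfl⟩ := mem_image.1 hq
    exact (hK _).2 ⟨x, (hp x hx).symm⟩
  have hsum : ∑ x ∈ K, (1 + (if x ∈ O then 1 else 0) + (if x ∈ B.image p then 1 else 0)) ≤
      ∑ x ∈ K, (F.degree x + (if x ∈ B then 1 else 0)) := by
    refine sum_le_sum fun x hx => ?_
    have h1 := hdegpos x hx
    by_cases hxp : x ∈ B.image p
    · obtain ⟨z, hz, rfl⟩ := mem_image.1 hxp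
      have := hpd z hz
      rw [if_neg (hpO z hz), if_pos hxp]
      omega
    · rw [if_neg hxp]
      have hB : x ∈ B ↔ x ∈ O ∧ F.degree x = 1 := mem_filter
      split_ifs with h2 h3 <;> grind
  simp only [sum_add_distrib, sum_ite_mem, inter_eq_right.2 hOK, inter_eq_right.2 hpK,
    inter_eq_right.2 (hBO.trans hOK), sum_const, smul_eq_mul, mul_one,
    card_image_of_injOn hpinj] at hsum
  have hdsum : ∑ x ∈ K, F.degree x ≤ 2 * C.ncard := by
    have h1 := F.sum_degrees_eq_twice_card_edges
    have h2 : C.ncard = #F.edgeFinset := by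
      rw [← hFE, Set.ncard_eq_toFinset_card']
      rfl
    rw [h2, ← h1]
    exact sum_le_sum_of_subset (subset_univ K)
  have htot : #G.support.toFinset ≤ #K + #(G.support.toFinset \ K) := by
    rw [add_comm]; exact card_le_card_sdiff_add_card
  rw [Set.ncard_eq_toFinset_card']
  omega

theorem ncard_le_four_mul_of_minimal [Finite V] {C D : Set (Sym2 V)}
    (hC : IsEdgeIdentifyingCode G C) (hmin : ∀ c ∈ C, ¬ IsEdgeIdentifyingCode G (C \ {c}))
    (hD : IsEdgeIdentifyingCode G D) : C.ncard ≤ 4 * D.ncard := by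
  rcases G.edgeSet.eq_empty_or_nonempty with h | h
  · have hC' := hC.1
    rw [h, Set.subset_empty_iff] at hC'
    simp [hC']
  · have h1 := ncard_add_three_le_of_minimal h hC hmin
    have h2 := support_ncard_le_two_mul hD
    omega

end Combinatorics

/-! ### A structured language on top of the random access machine -/

/-- `Runs P s T s'`: the program `P` takes the state `s` to the state `s'` in at most `T` steps. -/
def Runs (P : RAMProg) (s : RAMState) (T : ℕ) (s' : RAMState) : Prop :=
  ∃ t ≤ T, RAMExec P s t s'

namespace Runs

variable {P Q : RAMProg} {s s₁ s₂ : RAMState} {T T₁ T₂ : ℕ}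

theorem seq (h₁ : Runs P s T₁ s₁) (h₂ : Runs Q s₁ T₂ s₂) :
    Runs (.seq P Q) s (T₁ + T₂) s₂ := by
  obtain ⟨t₁, l₁, e₁⟩ := h₁
  obtain ⟨t₂, l₂, e₂⟩ := h₂
  exact ⟨_, add_le_add l₁ l₂, .seq e₁ e₂⟩

theorem mono (h : Runs P s T₁ s₁) (hT : T₁ ≤ T₂) : Runs P s T₂ s₁ := by
  obtain ⟨t, l, e⟩ := h
  exact ⟨t, l.trans hT, e⟩

theorem const (x c : ℕ) (s : RAMState) : Runs (.const x c) s 1 (s.setReg x c) :=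
  ⟨1, le_rfl, .const x c s⟩

theorem add (x y z : ℕ) (s : RAMState) :
    Runs (.add x y z) s 1 (s.setReg x (s.reg y + s.reg z)) := ⟨1, le_rfl, .add x y z s⟩

theorem sub (x y z : ℕ) (s : RAMState) :
    Runs (.sub x y z) s 1 (s.setReg x (s.reg y - s.reg z)) := ⟨1, le_rfl, .sub x y z s⟩

theorem load (x b y : ℕ) (s : RAMState) :
    Runs (.load x b y) s 1 (s.setReg x (s.bank b (s.reg y))) := ⟨1, le_rfl, .load x b y s⟩

theorem store (b y x : ℕ) (s : RAMState) :
    Runs (.store b y x) s 1 (s.setBank b (s.reg y) (s.reg x)) := ⟨1, le_rfl, .store b y x s⟩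

theorem loopStop {x : ℕ} (h : s.reg x = 0) : Runs (.loop x P) s 1 s := ⟨1, le_rfl, .loopStop h⟩

theorem loopStep {x : ℕ} (h : s.reg x ≠ 0) (h₁ : Runs P s T₁ s₁)
    (h₂ : Runs (.loop x P) s₁ T₂ s₂) : Runs (.loop x P) s (T₁ + T₂ + 1) s₂ := by
  obtain ⟨t₁, l₁, e₁⟩ := h₁
  obtain ⟨t₂, l₂, e₂⟩ := h₂
  exact ⟨_, by omega, .loopStep h e₁ e₂⟩

end Runs

@[simp] theorem RAMState.setReg_reg (s : RAMState) (x a r : ℕ) :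
    (s.setReg x a).reg r = if r = x then a else s.reg r := by
  simp [RAMState.setReg, Function.update_apply]

@[simp] theorem RAMState.setReg_bank (s : RAMState) (x a : ℕ) : (s.setReg x a).bank = s.bank := rfl

/-- The body of the loop in `forProg`: it runs `body`, increments the register `x`, and puts the
number of remaining rounds into the register `d`. -/
def forBody (x d : ℕ) (body : RAMProg) : RAMProg :=
  .seq body (.seq (.const d 1) (.seq (.add x x d) (.sub d 0 x)))

/-- The program `for x < n do body`, where `n` is the content of register `0`. It uses the registers
`d` and `d + 1` as scratch, and restores the old content of `x` in the end. -/
def forProg (x d : ℕ) (body : RAMProg) : RAMProg :=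
  .seq (.const d 0) (.seq (.add (d + 1) x d) (.seq (.const x 0) (.seq (.sub d 0 x)
    (.seq (.loop d (forBody x d body)) (.seq (.const d 0) (.add x (d + 1) d))))))

/-- The loop rule. Before round `i` the register `d + 2` holds `A i` and the banks are `B i`; the
registers below `d`, apart from the loop variable `x`, are those of the state `s`. -/
theorem forProg_loop_runs {x d n T : ℕ} {body : RAMProg} {A : ℕ → ℕ} {B : ℕ → ℕ → ℕ → ℕ}
    {s : RAMState} (hx : 0 < x) (hxd : x < d) (hn : s.reg 0 = n)
    (hbody : ∀ i < n, ∀ u : RAMState, (∀ r < d, u.reg r = Function.update s.reg x i r) →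
      u.reg (d + 2) = A i → u.bank = B i →
      ∃ u', Runs body u T u' ∧ (∀ r < d + 2, u'.reg r = u.reg r) ∧
        u'.reg (d + 2) = A (i + 1) ∧ u'.bank = B (i + 1)) :
    ∀ k i, i + k = n → ∀ u : RAMState, (∀ r < d, u.reg r = Function.update s.reg x i r) →
      u.reg d = k → u.reg (d + 2) = A i → u.bank = B i →
      ∃ u', Runs (.loop d (forBody x d body)) u (k * (T + 4) + 1) u' ∧
        (∀ r < d, u'.reg r = Function.update s.reg x n r) ∧ u'.reg (d + 1) = u.reg (d + 1) ∧
        u'.reg (d + 2) = A n ∧ u'.bank = B n := by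
  intro k
  induction k with
  | zero =>
    intro i hi u hr hd hA hB
    obtain rfl : i = n := by omega
    exact ⟨u, (Runs.loopStop hd).mono (by omega), hr, rfl, hA, hB⟩
  | succ k ih =>
    intro i hi u hr hd hA hB
    obtain ⟨v, hv, hvr, hvA, hvB⟩ := hbody i (by omega) u hr hA hB
    have hvx : v.reg x = i := by
      rw [hvr x (by omega), hr x hxd]; simp
    have hv0 : v.reg 0 = n := by
      rw [hvr 0 (by omega), hr 0 (by omega), Function.update_of_ne (by omega), hn]
    have key := hv.seq ((Runs.const d 1 _).seq ((Runs.add x x d _).seq (Runs.sub d 0 x _)))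
    set w := (((v.setReg d 1).setReg x _).setReg d _) with hw
    have hw' : ∀ r, w.reg r = if r = d then n - (i + 1) else if r = x then i + 1 else v.reg r := by
      intro r
      simp only [hw, RAMState.setReg_reg]
      grind
    obtain ⟨u', hu', h1, h2, h3, h4⟩ := ih (i + 1) (by omega) w
      (by
        intro r hrd
        rw [hw', if_neg (by omega), Function.update_apply, hvr r (by omega), hr r hrd,
          Function.update_apply]
        split_ifs <;> rfl)
      (by rw [hw', if_pos rfl]; omega)
      (by rw [hw', if_neg (by omega), if_neg (by omega), hvA]) (by simp [hw, hvB])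
    refine ⟨u', (Runs.loopStep (by omega) key hu').mono ?_, h1, ?_, h3, h4⟩
    · rw [add_mul]; omega
    · rw [h2, hw', if_neg (by omega), if_neg (by omega), hvr _ (by omega)]

theorem forProg_runs {x d n T : ℕ} {body : RAMProg} {A : ℕ → ℕ} {B : ℕ → ℕ → ℕ → ℕ}
    {s : RAMState} (hx : 0 < x) (hxd : x < d) (hn : s.reg 0 = n)
    (hA : s.reg (d + 2) = A 0) (hB : s.bank = B 0)
    (hbody : ∀ i < n, ∀ u : RAMState, (∀ r < d, u.reg r = Function.update s.reg x i r) →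
      u.reg (d + 2) = A i → u.bank = B i →
      ∃ u', Runs body u T u' ∧ (∀ r < d + 2, u'.reg r = u.reg r) ∧
        u'.reg (d + 2) = A (i + 1) ∧ u'.bank = B (i + 1)) :
    ∃ s', Runs (forProg x d body) s (n * (T + 4) + 7) s' ∧ (∀ r < d, s'.reg r = s.reg r) ∧
      s'.reg (d + 2) = A n ∧ s'.bank = B n := by
  have key := fun u' T' h => (Runs.const d 0 s).seq ((Runs.add (d + 1) x d _).seq
    ((Runs.const x 0 _).seq ((Runs.sub d 0 x _).seq
    ((h : Runs (.loop d (forBody x d body)) _ T' u').seq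
    ((Runs.const d 0 _).seq (Runs.add x (d + 1) d _))))))
  set w := ((((s.setReg d 0).setReg (d + 1) _).setReg x _).setReg d _) with hw
  have hw' : ∀ r, w.reg r = if r = d then n else if r = x then 0 else
      if r = d + 1 then s.reg x else s.reg r := by
    intro r
    simp only [hw, RAMState.setReg_reg]
    grind
  obtain ⟨u, hu, h1, h2, h3, h4⟩ := forProg_loop_runs hx hxd hn hbody n 0 (by omega) w
    (by
      intro r hrd
      rw [hw', if_neg (by omega), Function.update_apply, if_neg (show r ≠ d + 1 by omega)])
    (by rw [hw', if_pos rfl])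
    (by rw [hw', if_neg (by omega), if_neg (by omega), if_neg (by omega), hA]) (by simp [hw, hB])
  refine ⟨_, (key _ _ hu).mono (by omega), ?_, ?_, h4⟩
  · intro r hrd
    have h1' := h1 r hrd
    have hw1 := hw' (d + 1)
    rw [Function.update_apply] at h1'
    simp only [RAMState.setReg_reg, h2]
    grind
  · simp only [RAMState.setReg_reg]
    grind

/-- Terms of the structured language. `var r` is the content of register `r`, `load b a` is the
entry of bank `b` at the address `a`, and `sum x a` is the sum of `a` over all `x < n`, where `n` is
the content of register `0`. A term serves as a formula that holds if its value is nonzero; then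
`add` is disjunction, `sum` is a bounded existential quantifier, and `sub (const 1)` is negation. -/
inductive RAMTerm where
  | var (r : ℕ)
  | const (c : ℕ)
  | add (a b : RAMTerm)
  | sub (a b : RAMTerm)
  | load (b : ℕ) (a : RAMTerm)
  | sum (x : ℕ) (a : RAMTerm)

namespace RAMTerm

/-- The value of a term, given the contents of the registers and of the banks. -/
def eval : RAMTerm → (ℕ → ℕ) → (ℕ → ℕ → ℕ) → ℕ
  | var r, ρ, _ => ρ r
  | const c, _, _ => c
  | add a b, ρ, β => a.eval ρ β + b.eval ρ β
  | sub a b, ρ, β => a.eval ρ β - b.eval ρ β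
  | load b a, ρ, β => β b (a.eval ρ β)
  | sum x a, ρ, β => ∑ i ∈ Finset.range (ρ 0), a.eval (Function.update ρ x i) β

/-- All variables of the term are registers below `k`, and no binder binds register `0`. -/
def Scoped (k : ℕ) : RAMTerm → Prop
  | var r => r < k
  | const _ => True
  | add a b => a.Scoped k ∧ b.Scoped k
  | sub a b => a.Scoped k ∧ b.Scoped k
  | load _ a => a.Scoped k
  | sum x a => 0 < x ∧ x < k ∧ a.Scoped k

/-- A program that puts the value of the term into register `d`; it leaves the registers below `d`
and the banks as they are. -/
def compile : RAMTerm → ℕ → RAMProg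
  | var r, d => .seq (.const d 0) (.add d r d)
  | const c, d => .const d c
  | add a b, d => .seq (a.compile d) (.seq (b.compile (d + 1)) (.add d d (d + 1)))
  | sub a b, d => .seq (a.compile d) (.seq (b.compile (d + 1)) (.sub d d (d + 1)))
  | load b a, d => .seq (a.compile d) (.load d b d)
  | sum x a, d => .seq (.const (d + 2) 0) (.seq
      (forProg x d (.seq (a.compile (d + 3)) (.add (d + 2) (d + 2) (d + 3))))
      (.seq (.const d 0) (.add d (d + 2) d)))

/-- A bound for the running time of the compiled term as a function of `n`. -/
noncomputable def time : RAMTerm → Polynomial ℕ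
  | var _ => 2
  | const _ => 1
  | add a b => a.time + b.time + 1
  | sub a b => a.time + b.time + 1
  | load _ a => a.time + 1
  | sum _ a => Polynomial.X * (a.time + 1 + 4) + 10

theorem compile_runs {k : ℕ} (hk : 0 < k) (a : RAMTerm) : a.Scoped k →
    ∀ (d : ℕ) (s : RAMState) (ρ : ℕ → ℕ), k ≤ d → (∀ r < k, s.reg r = ρ r) →
    ∃ s', Runs (a.compile d) s (a.time.eval (ρ 0)) s' ∧ (∀ r < d, s'.reg r = s.reg r) ∧
      s'.reg d = a.eval ρ s.bank ∧ s'.bank = s.bank := by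
  induction a with
  | var r =>
    intro h d s ρ hd hs
    refine ⟨_, ((Runs.const d 0 s).seq (Runs.add d r d _)).mono (by simp [time]), ?_, ?_, rfl⟩
    · intro q hq; simp only [RAMState.setReg_reg]; grind
    · have : r < k := h
      simp only [RAMState.setReg_reg, eval, ← hs r h]; grind
  | const c =>
    intro h d s ρ hd hs
    refine ⟨_, (Runs.const d c s).mono (by simp [time]), ?_, ?_, rfl⟩
    · intro q hq; simp only [RAMState.setReg_reg]; grind
    · simp [eval]
  | add a b iha ihb =>
    intro h d s ρ hd hs
    obtain ⟨s₁, h1, h2, h3, h4⟩ := iha h.1 d s ρ hd hs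
    obtain ⟨s₂, g1, g2, g3, g4⟩ := ihb h.2 (d + 1) s₁ ρ (by omega)
      (fun r hr => by rw [h2 r (by omega), hs r hr])
    refine ⟨_, (h1.seq (g1.seq (Runs.add d d (d + 1) _))).mono ?_, ?_, ?_, ?_⟩
    · simp [time, add_assoc]
    · intro q hq
      rw [RAMState.setReg_reg, if_neg (by omega), g2 q (by omega), h2 q hq]
    · rw [RAMState.setReg_reg, if_pos rfl, g2 d (by omega), h3, g3, h4]; rfl
    · rw [RAMState.setReg_bank, g4, h4]
  | sub a b iha ihb =>
    intro h d s ρ hd hs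
    obtain ⟨s₁, h1, h2, h3, h4⟩ := iha h.1 d s ρ hd hs
    obtain ⟨s₂, g1, g2, g3, g4⟩ := ihb h.2 (d + 1) s₁ ρ (by omega)
      (fun r hr => by rw [h2 r (by omega), hs r hr])
    refine ⟨_, (h1.seq (g1.seq (Runs.sub d d (d + 1) _))).mono ?_, ?_, ?_, ?_⟩
    · simp [time, add_assoc]
    · intro q hq
      rw [RAMState.setReg_reg, if_neg (by omega), g2 q (by omega), h2 q hq]
    · rw [RAMState.setReg_reg, if_pos rfl, g2 d (by omega), h3, g3, h4]; rfl
    · rw [RAMState.setReg_bank, g4, h4]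
  | load b a iha =>
    intro h d s ρ hd hs
    obtain ⟨s₁, h1, h2, h3, h4⟩ := iha h d s ρ hd hs
    refine ⟨_, (h1.seq (Runs.load d b d _)).mono ?_, ?_, ?_, ?_⟩
    · simp [time]
    · intro q hq
      rw [RAMState.setReg_reg, if_neg (by omega), h2 q hq]
    · rw [RAMState.setReg_reg, if_pos rfl, h3, h4]; rfl
    · rw [RAMState.setReg_bank, h4]
  | sum x a iha =>
    intro h d s ρ hd hs
    obtain ⟨hx, hxk, ha⟩ := h
    set s₀ := s.setReg (d + 2) 0 with hs₀
    have hs₀r : ∀ r < d, s₀.reg r = s.reg r := by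
      intro r hr; rw [hs₀, RAMState.setReg_reg, if_neg (by omega)]
    obtain ⟨s₁, h1, h2, h3, h4⟩ := forProg_runs (T := a.time.eval (ρ 0) + 1) (n := ρ 0)
      (body := .seq (a.compile (d + 3)) (.add (d + 2) (d + 2) (d + 3)))
      (A := fun m => ∑ i ∈ Finset.range m, a.eval (Function.update ρ x i) s.bank)
      (B := fun _ => s.bank) (s := s₀) hx (hxk.trans_le hd)
      (by rw [hs₀r 0 (by omega), hs 0 hk]) (by simp [hs₀]) rfl
      (by
        intro i hi u hu hA hB
        obtain ⟨v, g1, g2, g3, g4⟩ := iha ha (d + 3) u (Function.update ρ x i) (by omega)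
          (fun r hr => by
            rw [hu r (by omega), Function.update_apply, Function.update_apply,
              hs₀r r (by omega), hs r hr])
        rw [Function.update_of_ne (by omega)] at g1
        refine ⟨_, g1.seq (Runs.add _ _ _ _), ?_, ?_, ?_⟩
        · intro r hr
          rw [RAMState.setReg_reg, if_neg (by omega), g2 r (by omega)]
        · rw [RAMState.setReg_reg, if_pos rfl, g2 _ (by omega), hA, g3, hB,
            Finset.sum_range_succ]
        · rw [RAMState.setReg_bank, g4, hB])
    refine ⟨_, ((Runs.const (d + 2) 0 s).seq (h1.seq
      ((Runs.const d 0 _).seq (Runs.add d (d + 2) d _)))).mono ?_, ?_, ?_, ?_⟩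
    · simp only [time, Polynomial.eval_add, Polynomial.eval_mul, Polynomial.eval_X,
        Polynomial.eval_ofNat, Polynomial.eval_one]
      omega
    · intro r hr
      rw [RAMState.setReg_reg, if_neg (by omega), RAMState.setReg_reg, if_neg (by omega), h2 r hr,
        hs₀r r hr]
    · rw [RAMState.setReg_reg, if_pos rfl, RAMState.setReg_reg, if_neg (by omega), h3,
        RAMState.setReg_reg, if_pos rfl]
      rfl
    · rw [RAMState.setReg_bank, RAMState.setReg_bank, h4]

/-- A term holds if its value is nonzero. -/
def Holds (a : RAMTerm) (ρ : ℕ → ℕ) (β : ℕ → ℕ → ℕ) : Prop := a.eval ρ β ≠ 0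

/-- Negation. -/
def neg (a : RAMTerm) : RAMTerm := sub (const 1) a

/-- Conjunction. -/
def and (a b : RAMTerm) : RAMTerm := neg (add (neg a) (neg b))

/-- The bounded universal quantifier. -/
def all (x : ℕ) (a : RAMTerm) : RAMTerm := neg (sum x (neg a))

/-- The formula `r ≠ q`, for registers `r` and `q`. -/
def ne (r q : ℕ) : RAMTerm := add (sub (var r) (var q)) (sub (var q) (var r))

/-- The formula `r = q`, for registers `r` and `q`. -/
def eq (r q : ℕ) : RAMTerm := neg (ne r q)

/-- The address `r * n + q` of the entry in row `r` and column `q` of an `n × n` matrix, for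
registers `r` and `q`; the machine does not multiply, so the product is a sum. The variable of the
sum does not matter, as long as it is not `r`. -/
def addr (r q : ℕ) : RAMTerm := add (sum (r + 1) (var r)) (var q)

variable {a b : RAMTerm} {ρ : ℕ → ℕ} {β : ℕ → ℕ → ℕ}

@[simp] theorem holds_neg : (neg a).Holds ρ β ↔ ¬ a.Holds ρ β := by
  simp only [Holds, neg, eval]; omega

@[simp] theorem holds_add : (add a b).Holds ρ β ↔ a.Holds ρ β ∨ b.Holds ρ β := by
  simp only [Holds, eval]; omega

@[simp] theorem holds_and : (and a b).Holds ρ β ↔ a.Holds ρ β ∧ b.Holds ρ β := by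
  simp [and]

@[simp] theorem holds_sum {x : ℕ} :
    (sum x a).Holds ρ β ↔ ∃ i < ρ 0, a.Holds (Function.update ρ x i) β := by
  simp [Holds, eval, Finset.sum_eq_zero_iff]

@[simp] theorem holds_all {x : ℕ} :
    (all x a).Holds ρ β ↔ ∀ i < ρ 0, a.Holds (Function.update ρ x i) β := by
  simp [all]

@[simp] theorem holds_ne {r q : ℕ} : (ne r q).Holds ρ β ↔ ρ r ≠ ρ q := by
  simp only [Holds, ne, eval]; omega

@[simp] theorem holds_eq {r q : ℕ} : (eq r q).Holds ρ β ↔ ρ r = ρ q := by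
  simp [eq]

@[simp] theorem holds_load {c : ℕ} : (load c a).Holds ρ β ↔ β c (a.eval ρ β) ≠ 0 := Iff.rfl

@[simp] theorem eval_addr (r q : ℕ) : (addr r q).eval ρ β = ρ r * ρ 0 + ρ q := by
  simp [addr, eval, mul_comm]

end RAMTerm

/-- Statements of the structured language: `store b a c` writes the value of `c` at the address `a`
of bank `b`, and `loop x p` is `for x < n do p`, where `n` is the content of register `0`. -/
inductive RAMStmt where
  | store (b : ℕ) (a c : RAMTerm)
  | seq (p q : RAMStmt)
  | loop (x : ℕ) (p : RAMStmt)

namespace RAMStmt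

/-- The banks after the execution of a statement, which leaves the registers as they are. -/
def run : RAMStmt → (ℕ → ℕ) → (ℕ → ℕ → ℕ) → (ℕ → ℕ → ℕ)
  | store b a c, ρ, β =>
      Function.update β b (Function.update (β b) (a.eval ρ β) (c.eval ρ β))
  | seq p q, ρ, β => q.run ρ (p.run ρ β)
  | loop x p, ρ, β => (List.range (ρ 0)).foldl (fun β i => p.run (Function.update ρ x i) β) β

/-- All variables of the statement are registers below `k`, and no binder binds register `0`. -/
def Scoped (k : ℕ) : RAMStmt → Prop
  | store _ a c => a.Scoped k ∧ c.Scoped k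
  | seq p q => p.Scoped k ∧ q.Scoped k
  | loop x p => 0 < x ∧ x < k ∧ p.Scoped k

/-- A program that executes the statement; it leaves the registers below `d` as they are. -/
def compile : RAMStmt → ℕ → RAMProg
  | store b a c, d => .seq (a.compile d) (.seq (c.compile (d + 1)) (.store b d (d + 1)))
  | seq p q, d => .seq (p.compile d) (q.compile d)
  | loop x p, d => forProg x d (p.compile (d + 3))

/-- A bound for the running time of the compiled statement as a function of `n`. -/
noncomputable def time : RAMStmt → Polynomial ℕ
  | store _ a c => a.time + c.time + 1
  | seq p q => p.time + q.time
  | loop _ p => Polynomial.X * (p.time + 4) + 7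

theorem compile_runs {k : ℕ} (hk : 0 < k) (p : RAMStmt) : p.Scoped k →
    ∀ (d : ℕ) (s : RAMState) (ρ : ℕ → ℕ), k ≤ d → (∀ r < k, s.reg r = ρ r) →
    ∃ s', Runs (p.compile d) s (p.time.eval (ρ 0)) s' ∧ (∀ r < d, s'.reg r = s.reg r) ∧
      s'.bank = p.run ρ s.bank := by
  induction p with
  | store b a c =>
    intro h d s ρ hd hs
    obtain ⟨s₁, h1, h2, h3, h4⟩ := a.compile_runs hk h.1 d s ρ hd hs
    obtain ⟨s₂, g1, g2, g3, g4⟩ := c.compile_runs hk h.2 (d + 1) s₁ ρ (by omega)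
      (fun r hr => by rw [h2 r (by omega), hs r hr])
    refine ⟨_, (h1.seq (g1.seq (Runs.store b d (d + 1) _))).mono ?_, ?_, ?_⟩
    · simp [time, add_assoc]
    · intro q hq
      exact (g2 q (by omega)).trans (h2 q hq)
    · simp only [RAMState.setBank, run]
      rw [g2 d (by omega), h3, g3, g4, h4]
  | seq p q ihp ihq =>
    intro h d s ρ hd hs
    obtain ⟨s₁, h1, h2, h3⟩ := ihp h.1 d s ρ hd hs
    obtain ⟨s₂, g1, g2, g3⟩ := ihq h.2 d s₁ ρ hd
      (fun r hr => by rw [h2 r (by omega), hs r hr])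
    refine ⟨_, (h1.seq g1).mono (by simp [time]), fun r hr => (g2 r hr).trans (h2 r hr), ?_⟩
    rw [g3, h3]; rfl
  | loop x p ih =>
    intro h d s ρ hd hs
    obtain ⟨hx, hxk, hp⟩ := h
    obtain ⟨s₁, h1, h2, h3, h4⟩ := forProg_runs (T := p.time.eval (ρ 0)) (n := ρ 0)
      (body := p.compile (d + 3)) (A := fun _ => s.reg (d + 2))
      (B := fun m => (List.range m).foldl (fun β i => p.run (Function.update ρ x i) β) s.bank)
      (s := s) hx (hxk.trans_le hd) (hs 0 hk) rfl rfl
      (by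
        intro i hi u hu hA hB
        obtain ⟨v, g1, g2, g3⟩ := ih hp (d + 3) u (Function.update ρ x i) (by omega)
          (fun r hr => by
            rw [hu r (by omega), Function.update_apply, Function.update_apply, hs r hr])
        rw [Function.update_of_ne (by omega)] at g1
        refine ⟨_, g1, fun r hr => g2 r (by omega), (g2 _ (by omega)).trans hA, ?_⟩
        simp [g3, hB, List.range_succ])
    refine ⟨_, h1.mono (by simp [time]), h2, h4⟩

/-- An invariant rule for loops. -/
theorem run_loop_induction {x n : ℕ} {p : RAMStmt} {ρ : ℕ → ℕ} {β : ℕ → ℕ → ℕ} (hn : ρ 0 = n)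
    (I : ℕ → (ℕ → ℕ → ℕ) → Prop) (h0 : I 0 β)
    (hs : ∀ i < n, ∀ γ, I i γ → I (i + 1) (p.run (Function.update ρ x i) γ)) :
    I n ((loop x p).run ρ β) := by
  have key : ∀ m ≤ n,
      I m ((List.range m).foldl (fun β i => p.run (Function.update ρ x i) β) β) := by
    intro m
    induction m with
    | zero => intro _; simpa using h0
    | succ m ih =>
      intro hm
      simpa [List.range_succ] using hs m hm _ (ih (by omega))
  rw [run, hn]
  exact key n le_rfl

end RAMStmt

/-! ### Greedy deletion as a program -/

/-- The set of addresses at which bank `1` holds a nonzero value. -/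
def markedSet (β : ℕ → ℕ → ℕ) : Set ℕ := {a | β 1 a ≠ 0}

/-- The situation in greedy deletion from `S` when the addresses below `m` have been processed and
`A` is what is left. -/
structure GreedyInvariant (S : Set ℕ) (P : Set ℕ → Prop) (m : ℕ) (A : Set ℕ) : Prop where
  subset : A ⊆ S
  unprocessed : ∀ a ≥ m, a ∈ S → a ∈ A
  feasible : P S → P A
  minimal : ∀ a < m, a ∈ A → ¬ P (A \ {a})

theorem GreedyInvariant.step {S : Set ℕ} {P : Set ℕ → Prop} {m : ℕ} {A A' : Set ℕ}
    (hmono : ∀ A B, A ⊆ B → B ⊆ S → P A → P B) (h : GreedyInvariant S P m A)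
    (hne : ∀ a ≠ m, a ∈ A' ↔ a ∈ A) (hm : m ∈ A' ↔ m ∈ S ∧ ¬ P (A \ {m})) :
    GreedyInvariant S P (m + 1) A' := by
  have hmA : m ∈ S → m ∈ A := h.unprocessed m le_rfl
  have hA'A : A' ⊆ A := by
    intro a ha
    by_cases ham : a = m
    · subst ham; exact hmA (hm.1 ha).1
    · exact (hne a ham).1 ha
  refine ⟨hA'A.trans h.subset, fun a ha haS => ?_, fun hS => ?_, fun a ha haA' hP => ?_⟩
  · exact (hne a (by omega)).2 (h.unprocessed a (by omega) haS)
  · by_cases hmA' : m ∈ A'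
    · refine hmono A A' (fun a ha => ?_) (hA'A.trans h.subset) (h.feasible hS)
      by_cases ham : a = m
      · subst ham; exact hmA'
      · exact (hne a ham).2 ha
    · by_cases hmS : m ∈ S
      · have hP : P (A \ {m}) := by by_contra hP; exact hmA' (hm.2 ⟨hmS, hP⟩)
        exact hmono _ _ (fun a ha => (hne a ha.2).2 ha.1) (hA'A.trans h.subset) hP
      · refine hmono A A' (fun a ha => ?_) (hA'A.trans h.subset) (h.feasible hS)
        refine (hne a ?_).2 ha
        rintro rfl
        exact hmS (h.subset ha)
  · have hP' : P (A \ {a}) :=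
      hmono _ _ (Set.sdiff_subset_sdiff_left hA'A) (Set.sdiff_subset.trans h.subset) hP
    rcases Nat.lt_succ_iff_lt_or_eq.1 ha with ham | rfl
    · exact h.minimal a ham (hA'A haA') hP'
    · exact (hm.1 haA').2 hP'

/-- Mark the address `ad` if the formula `valid` holds. -/
def markStmt (ad valid : RAMTerm) : RAMStmt := .store 1 ad valid

/-- Unmark the address `ad`, and mark it again if it is `valid` and the formula `code` fails for the
set of marked addresses. -/
def deleteStmt (ad valid code : RAMTerm) : RAMStmt :=
  .seq (.store 1 ad (.const 0)) (.store 1 ad (.and valid (.neg code)))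

theorem markedSet_run_deleteStmt {ad valid code : RAMTerm} {ρ : ℕ → ℕ} {m : ℕ}
    (had : ∀ γ, ad.eval ρ γ = m) {S : Set ℕ} {P : Set ℕ → Prop} {b : ℕ → ℕ}
    (hvalid : ∀ γ, γ 0 = b → (valid.Holds ρ γ ↔ m ∈ S))
    (hcode : ∀ γ, γ 0 = b → markedSet γ ⊆ S → (code.Holds ρ γ ↔ P (markedSet γ)))
    {β : ℕ → ℕ → ℕ} (hb : β 0 = b) (hβ : markedSet β ⊆ S) :
    (deleteStmt ad valid code).run ρ β 0 = b ∧
    (∀ a ≠ m, a ∈ markedSet ((deleteStmt ad valid code).run ρ β) ↔ a ∈ markedSet β) ∧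
    (m ∈ markedSet ((deleteStmt ad valid code).run ρ β) ↔ m ∈ S ∧ ¬ P (markedSet β \ {m})) := by
  set γ := Function.update β 1 (Function.update (β 1) m 0) with hγ
  have hγ0 : γ 0 = b := by rw [hγ, Function.update_of_ne (by omega), hb]
  have hγm : markedSet γ = markedSet β \ {m} := by
    ext a
    simp only [markedSet, hγ, Function.update_self, Function.update_apply, Set.mem_ofPred_eq,
      Set.mem_sdiff, Set.mem_singleton_iff]
    split_ifs <;> simp_all
  have hrun : (deleteStmt ad valid code).run ρ β =
      Function.update γ 1 (Function.update (γ 1) m ((RAMTerm.and valid (.neg code)).eval ρ γ)) := by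
    simp only [deleteStmt, RAMStmt.run, had, RAMTerm.eval, ← hγ]
  have hsub : markedSet γ ⊆ S := hγm ▸ Set.sdiff_subset.trans hβ
  have hval : (RAMTerm.and valid (.neg code)).eval ρ γ ≠ 0 ↔ m ∈ S ∧ ¬ P (markedSet β \ {m}) := by
    have := RAMTerm.holds_and (a := valid) (b := .neg code) (ρ := ρ) (β := γ)
    rwa [RAMTerm.holds_neg, hvalid γ hγ0, hcode γ hγ0 hsub, hγm] at this
  refine ⟨?_, fun a ha => ?_, ?_⟩
  · rw [hrun, Function.update_of_ne (by omega), hγ0]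
  · rw [hrun]
    simp [markedSet, hγ, ha]
  · rw [hrun, ← hval]
    simp [markedSet]

/-- The program that marks all valid addresses, then runs through the addresses in a second scan and
unmarks each one that `code` does not need, and at last evaluates `code` into register `0`. The
variables of statements and formulas are registers below `9`; the compiled code uses the others. -/
def greedyProg (scan : RAMStmt → RAMStmt) (ad valid code : RAMTerm) : RAMProg :=
  .seq ((RAMStmt.seq (scan (markStmt ad valid)) (scan (deleteStmt ad valid code))).compile 9)
    (.seq (code.compile 9) (.seq (.const 0 0) (.add 0 9 0)))

/-- The greedy program is correct: it computes a set `A` that no deletion leaves feasible, and it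
decides whether `A` is feasible, which is equivalent to the feasibility of the set of all valid
addresses. The hypothesis `hscan` is the invariant rule for a loop over the addresses `m < M`. -/
theorem greedyProg_correct {scan : RAMStmt → RAMStmt} {ad valid code : RAMTerm}
    (hscope : ((RAMStmt.seq (scan (markStmt ad valid)) (scan (deleteStmt ad valid code)))).Scoped 9)
    (hcodescope : code.Scoped 9) {M : ℕ → ℕ}
    (hscan : ∀ (p : RAMStmt) (n : ℕ) (ρ : ℕ → ℕ) (β : ℕ → ℕ → ℕ)
      (I : ℕ → (ℕ → ℕ → ℕ) → Prop), ρ 0 = n → I 0 β →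
      (∀ m < M n, ∀ ρ' : ℕ → ℕ, ρ' 0 = n → (∀ γ, ad.eval ρ' γ = m) →
        ∀ γ, I m γ → I (m + 1) (p.run ρ' γ)) → I (M n) ((scan p).run ρ β))
    {S : ∀ n, SimpleGraph (Fin n) → Set ℕ} {P : ∀ n, SimpleGraph (Fin n) → Set ℕ → Prop}
    (hM : ∀ n G, ∀ a ∈ S n G, a < M n)
    (hmono : ∀ n G A B, A ⊆ B → B ⊆ S n G → P n G A → P n G B)
    (hvalid : ∀ n G (ρ : ℕ → ℕ) m γ, ρ 0 = n → (∀ γ, ad.eval ρ γ = m) → m < M n →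
      γ 0 = (graphInput G).bank 0 → (valid.Holds ρ γ ↔ m ∈ S n G))
    (hcode : ∀ n (G : SimpleGraph (Fin n)) (ρ : ℕ → ℕ) γ, ρ 0 = n →
      γ 0 = (graphInput G).bank 0 → markedSet γ ⊆ S n G →
      (code.Holds ρ γ ↔ P n G (markedSet γ))) :
    ∃ T : Polynomial ℕ, ∀ (n : ℕ) (G : SimpleGraph (Fin n)), ∃ (t : ℕ) (s : RAMState),
      RAMExec (greedyProg scan ad valid code) (graphInput G) t s ∧ t ≤ T.eval n ∧
      markedSet s.bank ⊆ S n G ∧ (s.reg 0 ≠ 0 ↔ P n G (markedSet s.bank)) ∧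
      (P n G (S n G) → P n G (markedSet s.bank)) ∧
      ∀ a ∈ markedSet s.bank, ¬ P n G (markedSet s.bank \ {a}) := by
  refine ⟨(RAMStmt.seq (scan (markStmt ad valid)) (scan (deleteStmt ad valid code))).time +
    (code.time + 2), fun n G => ?_⟩
  set ρ := (graphInput G).reg with hρ
  have hρ0 : ρ 0 = n := by simp [hρ, graphInput]
  have hmark := hscan (markStmt ad valid) n ρ (graphInput G).bank
    (fun m γ => γ 0 = (graphInput G).bank 0 ∧ ∀ a, a ∈ markedSet γ ↔ a ∈ S n G ∧ a < m) hρ0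
    ⟨rfl, fun a => by simp [markedSet, graphInput]⟩
    (by
      rintro m hm ρ' hρ' had γ ⟨h0, hγ⟩
      refine ⟨by rw [markStmt, RAMStmt.run, Function.update_of_ne (by omega), h0], fun a => ?_⟩
      have hv := hvalid n G ρ' m γ hρ' had hm h0
      by_cases ham : a = m
      · subst ham
        simpa [markStmt, RAMStmt.run, markedSet, had, RAMTerm.Holds] using hv
      · have := hγ a
        simp only [markedSet, Set.mem_ofPred_eq] at this
        simp only [markStmt, RAMStmt.run, markedSet, had, Set.mem_ofPred_eq, Function.update_self,
          Function.update_of_ne ham, this]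
        refine and_congr_right fun _ => ?_
        omega)
  set β := (scan (markStmt ad valid)).run ρ (graphInput G).bank with hβ
  have hβS : markedSet β = S n G := by
    ext a
    rw [hmark.2 a]
    exact ⟨And.left, fun h => ⟨h, hM n G a h⟩⟩
  have hdel := hscan (deleteStmt ad valid code) n ρ β
    (fun m γ => γ 0 = (graphInput G).bank 0 ∧ GreedyInvariant (S n G) (P n G) m (markedSet γ)) hρ0
    ⟨hmark.1, hβS ▸ ⟨subset_rfl, fun _ _ h => h, fun h => h,
      fun _ h => absurd h (Nat.not_lt_zero _)⟩⟩
    (by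
      rintro m hm ρ' hρ' had γ ⟨h0, hγ⟩
      obtain ⟨h1, h2, h3⟩ := markedSet_run_deleteStmt (P := P n G) had
        (fun δ hδ => hvalid n G ρ' m δ hρ' had hm hδ)
        (fun δ hδ hδS => hcode n G ρ' δ hρ' hδ hδS) h0 hγ.subset
      exact ⟨h1, hγ.step (hmono n G) h2 h3⟩)
  obtain ⟨s₁, e1, r1, b1⟩ := RAMStmt.compile_runs (by omega) _ hscope 9 (graphInput G) ρ le_rfl
    (fun _ _ => rfl)
  obtain ⟨s₂, e2, r2, v2, b2⟩ := RAMTerm.compile_runs (by omega) _ hcodescope 9 s₁ ρ le_rfl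
    (fun r hr => r1 r hr)
  obtain ⟨t, ht, hexec⟩ := e1.seq (e2.seq ((Runs.const 0 0 _).seq (Runs.add 0 9 0 _)))
  have hb : s₂.bank = (scan (deleteStmt ad valid code)).run ρ β := by
    rw [b2, b1, RAMStmt.run, ← hβ]
  rw [← hb] at hdel
  have hv : s₂.reg 9 ≠ 0 ↔ P n G (markedSet s₂.bank) := by
    rw [v2, ← b2]
    exact hcode n G ρ s₂.bank hρ0 hdel.1 hdel.2.subset
  refine ⟨t, _, hexec, ?_, hdel.2.subset, ?_, hdel.2.feasible, fun a ha =>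
    hdel.2.minimal a (hM n G a (hdel.2.subset ha)) ha⟩
  · simpa [hρ0] using ht
  · simpa using hv

/-! ### The adjacency matrix in memory -/

/-- The address of an entry of an `n × n` matrix determines its row and its column. -/
theorem pair_eq_of_address_eq {n : ℕ} {i j i' j' : Fin n}
    (h : (i : ℕ) * n + j = i' * n + j') : i = i' ∧ j = j' := by
  have hi : (i : ℕ) = i' := by
    have h1 := Nat.add_mul_div_right (j : ℕ) i (Fin.pos i)
    have h2 := Nat.add_mul_div_right (j' : ℕ) i' (Fin.pos i)
    rw [Nat.div_eq_of_lt j.2] at h1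
    rw [Nat.div_eq_of_lt j'.2] at h2
    have h3 : (j : ℕ) + i * n = j' + i' * n := by omega
    rw [h3, h2] at h1
    omega
  rw [hi] at h
  exact ⟨Fin.ext hi, Fin.ext (by omega)⟩

theorem graphInput_bank_zero {n : ℕ} (G : SimpleGraph (Fin n)) (i j : Fin n) :
    (graphInput G).bank 0 ((i : ℕ) * n + j) ≠ 0 ↔ G.Adj i j := by
  simp only [graphInput, ne_eq, ite_eq_right_iff, one_ne_zero, imp_false, not_not, true_and]
  constructor
  · rintro ⟨i', j', h, hadj⟩
    rwa [(pair_eq_of_address_eq h).1, (pair_eq_of_address_eq h).2]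
  · exact fun h => ⟨i, j, rfl, h⟩

/-! ### The program for edge-identifying codes -/

namespace RAMTerm

/-- Exactly one of two formulas holds. -/
def xor (a b : RAMTerm) : RAMTerm := add (and a (neg b)) (and (neg a) b)

@[simp] theorem holds_xor {a b : RAMTerm} {ρ : ℕ → ℕ} {β : ℕ → ℕ → ℕ} :
    (xor a b).Holds ρ β ↔ ¬ (a.Holds ρ β ↔ b.Holds ρ β) := by
  simp only [xor, holds_add, holds_and, holds_neg]
  tauto

/-- The pairs in the registers `r`, `q` and in the registers `r'`, `q'` share an entry. -/
def meets (r q r' q' : ℕ) : RAMTerm := add (add (eq r r') (eq r q')) (add (eq q r') (eq q q'))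

/-- The pairs in the registers `r`, `q` and in the registers `r'`, `q'` are equal up to order. -/
def samePair (r q r' q' : ℕ) : RAMTerm :=
  add (and (eq r r') (eq q q')) (and (eq r q') (eq q r'))

/-- The marked pairs form an edge-identifying code. The pairs `(3, 4)` and `(5, 6)` of registers
range over the edges, and `(7, 8)` over the code. -/
def edgeCode : RAMTerm :=
  and
    (all 3 (all 4 (add (neg (load 0 (addr 3 4)))
      (sum 7 (sum 8 (and (load 1 (addr 7 8)) (meets 3 4 7 8)))))))
    (all 3 (all 4 (all 5 (all 6 (add (neg (load 0 (addr 3 4))) (add (neg (load 0 (addr 5 6)))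
      (add (samePair 3 4 5 6)
        (sum 7 (sum 8 (and (load 1 (addr 7 8)) (xor (meets 3 4 7 8) (meets 5 6 7 8))))))))))))

end RAMTerm

/-- The set of pairs whose address lies in `A`, in one of the two orders. -/
def pairsOf (n : ℕ) (A : Set ℕ) : Set (Sym2 (Fin n)) :=
  {e | ∃ i j : Fin n, e = s(i, j) ∧ (i : ℕ) * n + j ∈ A}

theorem exists_mem_pairsOf {n : ℕ} {A : Set ℕ} {p : Sym2 (Fin n) → Prop} :
    (∃ c ∈ pairsOf n A, p c) ↔ ∃ i j : Fin n, (i : ℕ) * n + j ∈ A ∧ p s(i, j) := by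
  constructor
  · rintro ⟨_, ⟨i, j, rfl, h⟩, hp⟩
    exact ⟨i, j, h, hp⟩
  · rintro ⟨i, j, h, hp⟩
    exact ⟨_, ⟨i, j, rfl, h⟩, hp⟩

theorem pairsOf_mono {n : ℕ} {A B : Set ℕ} (h : A ⊆ B) : pairsOf n A ⊆ pairsOf n B := by
  rintro _ ⟨i, j, rfl, ha⟩
  exact ⟨i, j, rfl, h ha⟩

/-- The addresses of the edges; each edge has two. -/
def edgeAddresses {n : ℕ} (G : SimpleGraph (Fin n)) : Set ℕ :=
  {a | ∃ i j : Fin n, a = (i : ℕ) * n + j ∧ G.Adj i j}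

theorem mem_edgeAddresses {n : ℕ} {G : SimpleGraph (Fin n)} {i j : Fin n} :
    (i : ℕ) * n + j ∈ edgeAddresses G ↔ G.Adj i j := by
  constructor
  · rintro ⟨i', j', h, hadj⟩
    rwa [(pair_eq_of_address_eq h).1, (pair_eq_of_address_eq h).2]
  · exact fun h => ⟨i, j, rfl, h⟩

theorem pairsOf_edgeAddresses {n : ℕ} (G : SimpleGraph (Fin n)) :
    pairsOf n (edgeAddresses G) = G.edgeSet := by
  ext e
  constructor
  · rintro ⟨i, j, rfl, h⟩
    exact mem_edgeAddresses.1 h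
  · induction e with | _ i j =>
    exact fun h => ⟨i, j, rfl, mem_edgeAddresses.2 h⟩

theorem meets_mk {V : Type*} {a b c d : V} :
    Meets s(a, b) s(c, d) ↔ (a = c ∨ a = d) ∨ b = c ∨ b = d := by
  simp [Meets]

theorem holds_edgeCode {n : ℕ} {G : SimpleGraph (Fin n)} {ρ : ℕ → ℕ} {β : ℕ → ℕ → ℕ}
    (hρ : ρ 0 = n) (hβ : β 0 = (graphInput G).bank 0) (hS : markedSet β ⊆ edgeAddresses G) :
    RAMTerm.edgeCode.Holds ρ β ↔ IsEdgeIdentifyingCode G (pairsOf n (markedSet β)) := by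
  have hsub : pairsOf n (markedSet β) ⊆ G.edgeSet :=
    pairsOf_edgeAddresses G ▸ pairsOf_mono hS
  have hadj : ∀ i (hi : i < n) j (hj : j < n), β 0 (i * n + j) ≠ 0 ↔ G.Adj ⟨i, hi⟩ ⟨j, hj⟩ := by
    intro i hi j hj
    rw [hβ]
    exact graphInput_bank_zero G ⟨i, hi⟩ ⟨j, hj⟩
  have hmark : ∀ a, a ∈ markedSet β ↔ β 1 a ≠ 0 := fun _ => Iff.rfl
  simp only [isEdgeIdentifyingCode_iff, hsub, true_and, exists_mem_pairsOf, Sym2.forall,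
    SimpleGraph.mem_edgeSet, meets_mk, Fin.forall_iff, Fin.exists_iff, ← hadj, hmark]
  simp only [RAMTerm.edgeCode, RAMTerm.holds_and, RAMTerm.holds_all, RAMTerm.holds_add,
    RAMTerm.holds_neg, RAMTerm.holds_load, RAMTerm.eval_addr, RAMTerm.holds_sum, RAMTerm.meets,
    RAMTerm.samePair, RAMTerm.holds_eq, RAMTerm.holds_xor, Function.update_apply]
  norm_num [hρ]
  refine and_congr (forall₄_congr fun i _ j _ => ?_) (forall₄_congr fun i _ j _ => ⟨?_, ?_⟩)
  · rw [or_iff_not_imp_left]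
    refine imp_congr_right fun _ => exists_congr fun c => and_congr_right fun _ =>
      exists_congr fun d => ?_
    tauto
  · intro h h1 i' hi' j' hj' h2 h3 h4
    rcases h i' hi' j' hj' with h | h | h | ⟨c, hc, d, hd, hm, hx⟩
    · exact absurd h h1
    · exact absurd h h2
    · tauto
    · exact ⟨c, hc, d, hm, hd, hx⟩
  · intro h i' hi' j' hj'
    by_contra hcon
    simp only [not_or] at hcon
    obtain ⟨h1, h2, h3, h4⟩ := hcon
    obtain ⟨c, hc, d, hm, hd, hx⟩ := h h1 i' hi' j' hj' h2 (by tauto) (by tauto)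
    exact h4 ⟨c, hc, d, hd, hm, hx⟩

theorem approximable_edgeIdentifyingCode :
    ApproximableInPolyTime 4 (fun _ _ => True) outputPairs
      (fun _ G C => IsEdgeIdentifyingCode G C) := by
  obtain ⟨T, hT⟩ := greedyProg_correct (scan := fun p => .loop 1 (.loop 2 p))
    (ad := .addr 1 2) (valid := .load 0 (.addr 1 2)) (code := .edgeCode) (M := fun n => n * n)
    (S := fun _ G => edgeAddresses G) (P := fun n G A => IsEdgeIdentifyingCode G (pairsOf n A))
    (by simp [RAMStmt.Scoped, RAMTerm.Scoped, markStmt, deleteStmt, RAMTerm.addr, RAMTerm.edgeCode,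
          RAMTerm.and, RAMTerm.all, RAMTerm.neg, RAMTerm.meets, RAMTerm.samePair, RAMTerm.xor,
          RAMTerm.eq, RAMTerm.ne])
    (by simp [RAMTerm.Scoped, RAMTerm.addr, RAMTerm.edgeCode,
          RAMTerm.and, RAMTerm.all, RAMTerm.neg, RAMTerm.meets, RAMTerm.samePair, RAMTerm.xor,
          RAMTerm.eq, RAMTerm.ne])
    (by
      intro p n ρ β I hρ h0 hI
      refine RAMStmt.run_loop_induction hρ (fun i γ => I (i * n) γ) (by simpa using h0) ?_
      intro i hi γ hγ
      rw [add_mul, one_mul]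
      refine RAMStmt.run_loop_induction (n := n) (by simpa using hρ)
        (fun j γ => I (i * n + j) γ) hγ ?_
      intro j hj δ hδ
      refine hI (i * n + j) (by nlinarith) _ (by simpa using hρ) (fun γ => ?_) δ hδ
      simp [hρ])
    (by
      rintro n G _ ⟨i, j, rfl, -⟩
      have := i.2
      have := j.2
      nlinarith)
    (fun n G A B hAB hB hA => hA.mono (pairsOf_mono hAB)
      (pairsOf_edgeAddresses G ▸ pairsOf_mono hB))
    (by
      intro n G ρ m γ hρ had hm hγ
      rw [RAMTerm.holds_load, had, hγ]
      simp [graphInput, edgeAddresses])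
    (fun n G ρ γ hρ hγ hS => holds_edgeCode hρ hγ hS)
  refine ⟨greedyProg (fun p => .loop 1 (.loop 2 p)) (.addr 1 2) (.load 0 (.addr 1 2)) .edgeCode, T,
    fun n G => ?_⟩
  obtain ⟨t, s, hexec, ht, hsub, hreg, hfeas, hmin⟩ := hT n G
  have hout : outputPairs n s = pairsOf n (markedSet s.bank) := rfl
  refine ⟨t, s, hexec, ht, fun _ => ⟨hreg.trans ⟨fun h => ⟨_, h⟩, fun ⟨C, hC⟩ => hfeas ?_⟩,
    fun h => ?_⟩⟩
  · exact hC.mono (pairsOf_edgeAddresses G ▸ hC.1) (pairsOf_edgeAddresses G).subset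
  · have hcode := hreg.1 h
    refine hout ▸ ⟨hcode, fun D hD => ncard_le_four_mul_of_minimal hcode ?_ hD⟩
    -- An edge is marked at up to two addresses, but already the unmarking of one fails.
    rintro _ ⟨i, j, rfl, ha⟩ hD
    refine hmin _ ha (hD.mono ?_ ?_)
    · rintro _ ⟨⟨i', j', rfl, ha'⟩, hne⟩
      refine ⟨i', j', rfl, ha', fun h => hne ?_⟩
      rw [(pair_eq_of_address_eq h).1, (pair_eq_of_address_eq h).2, Set.mem_singleton_iff]
    · exact pairsOf_edgeAddresses G ▸ pairsOf_mono (Set.sdiff_subset.trans hsub)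

/-! ### The program for identifying codes of line graphs -/

theorem isIdentifyingCode_iff {V : Type*} {G : SimpleGraph V} {C : Set V} :
    IsIdentifyingCode G C ↔ (∀ v, ∃ c ∈ C, c ∈ closedNbhd G v) ∧
      ∀ u v, u ≠ v → ∃ c ∈ C, ¬ (c ∈ closedNbhd G u ↔ c ∈ closedNbhd G v) := by
  unfold IsIdentifyingCode
  refine and_congr (forall_congr' fun v => ?_) (forall₃_congr fun u v _ => ?_)
  · exact exists_congr fun c => and_comm
  · rw [Ne, Set.ext_iff, not_forall]
    refine exists_congr fun c => ?_
    simp only [Set.mem_inter_iff]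
    tauto

theorem IsIdentifyingCode.mono {V : Type*} {G : SimpleGraph V} {C D : Set V}
    (hC : IsIdentifyingCode G C) (hCD : C ⊆ D) : IsIdentifyingCode G D := by
  rw [isIdentifyingCode_iff] at hC ⊢
  refine ⟨fun v => ?_, fun u v huv => ?_⟩
  · obtain ⟨c, hc, h⟩ := hC.1 v
    exact ⟨c, hCD hc, h⟩
  · obtain ⟨c, hc, h⟩ := hC.2 u v huv
    exact ⟨c, hCD hc, h⟩

/-- An isomorphism from `G` to the line graph of `H` takes identifying codes of `G` to
edge-identifying codes of `H`. -/
theorem isEdgeIdentifyingCode_image_iff {V W : Type*} {G : SimpleGraph V} {H : SimpleGraph W}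
    (φ : G ≃g H.lineGraph) {C : Set V} :
    IsEdgeIdentifyingCode H ((fun v => (φ v : Sym2 W)) '' C) ↔ IsIdentifyingCode G C := by
  have hmeets : ∀ u v, Meets (φ u : Sym2 W) (φ v) ↔ v ∈ closedNbhd G u := by
    intro u v
    by_cases huv : v = u
    · subst huv
      exact iff_of_true ⟨_, Sym2.out_fst_mem _, Sym2.out_fst_mem _⟩ (.inl rfl)
    · have hne : φ u ≠ φ v := fun h => huv (φ.injective h).symm
      have h1 : v ∈ closedNbhd G u ↔ G.Adj u v := or_iff_right huv
      rw [h1, ← φ.map_adj_iff, SimpleGraph.lineGraph_adj_iff_exists]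
      simp only [hne, ne_eq, not_false_eq_true, true_and]
      rfl
  have hall : ∀ p : Sym2 W → Prop, (∀ e ∈ H.edgeSet, p e) ↔ ∀ v, p (φ v) := fun p =>
    ⟨fun h v => h _ (φ v).2, fun h e he => by simpa using h (φ.symm ⟨e, he⟩)⟩
  have hsub : (fun v => (φ v : Sym2 W)) '' C ⊆ H.edgeSet := by
    rintro _ ⟨v, -, rfl⟩
    exact (φ v).2
  simp only [isEdgeIdentifyingCode_iff, isIdentifyingCode_iff, hsub, true_and, hall,
    Set.exists_mem_image, hmeets, ne_eq, Subtype.coe_inj, φ.injective.eq_iff]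

theorem ncard_le_four_mul_of_isLineGraph {n : ℕ} {G : SimpleGraph (Fin n)} (hG : IsLineGraph G)
    {C D : Set (Fin n)} (hC : IsIdentifyingCode G C)
    (hmin : ∀ c ∈ C, ¬ IsIdentifyingCode G (C \ {c})) (hD : IsIdentifyingCode G D) :
    C.ncard ≤ 4 * D.ncard := by
  obtain ⟨m, H, ⟨φ⟩⟩ := hG
  have hinj : Function.Injective (fun v => (φ v : Sym2 (Fin m))) :=
    Subtype.val_injective.comp φ.injective
  rw [← isEdgeIdentifyingCode_image_iff φ] at hC hD
  have := ncard_le_four_mul_of_minimal hC ?_ hD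
  · rwa [Set.ncard_image_of_injective _ hinj, Set.ncard_image_of_injective _ hinj] at this
  · rintro _ ⟨c, hc, rfl⟩ h
    rw [← Set.image_singleton (f := fun v => (φ v : Sym2 (Fin m))), ← Set.image_sdiff hinj,
      isEdgeIdentifyingCode_image_iff] at h
    exact hmin c hc h

namespace RAMTerm

/-- The vertex in register `q` lies in the closed neighbourhood of the vertex in register `r`. -/
def closedAdj (r q : ℕ) : RAMTerm := add (eq q r) (load 0 (addr r q))

/-- The marked vertices form an identifying code. The registers `3` and `4` range over the vertices,
and `5` over the code. -/
def vertexCode : RAMTerm :=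
  and
    (all 3 (sum 5 (and (load 1 (var 5)) (closedAdj 3 5))))
    (all 3 (all 4 (add (eq 3 4)
      (sum 5 (and (load 1 (var 5)) (xor (closedAdj 3 5) (closedAdj 4 5)))))))

end RAMTerm

theorem holds_vertexCode {n : ℕ} {G : SimpleGraph (Fin n)} {ρ : ℕ → ℕ} {β : ℕ → ℕ → ℕ}
    (hρ : ρ 0 = n) (hβ : β 0 = (graphInput G).bank 0) :
    RAMTerm.vertexCode.Holds ρ β ↔ IsIdentifyingCode G {v | (v : ℕ) ∈ markedSet β} := by
  have hadj : ∀ i (hi : i < n) j (hj : j < n), β 0 (i * n + j) ≠ 0 ↔ G.Adj ⟨i, hi⟩ ⟨j, hj⟩ := by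
    intro i hi j hj
    rw [hβ]
    exact graphInput_bank_zero G ⟨i, hi⟩ ⟨j, hj⟩
  have hmark : ∀ a, a ∈ markedSet β ↔ β 1 a ≠ 0 := fun _ => Iff.rfl
  simp only [isIdentifyingCode_iff, Fin.forall_iff, Fin.exists_iff, closedNbhd, Set.mem_ofPred_eq,
    ← hadj, hmark]
  simp only [RAMTerm.vertexCode, RAMTerm.holds_and, RAMTerm.holds_all, RAMTerm.holds_add,
    RAMTerm.holds_load, RAMTerm.eval_addr, RAMTerm.holds_sum, RAMTerm.closedAdj, RAMTerm.eval,
    RAMTerm.holds_eq, RAMTerm.holds_xor, Function.update_apply]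
  norm_num [hρ]
  refine and_congr (forall₂_congr fun i _ => exists_congr fun c => and_left_comm)
    (forall₄_congr fun i _ j _ => ?_)
  rw [or_iff_not_imp_left]
  exact imp_congr_right fun _ => exists_congr fun c => and_left_comm

theorem approximable_identifyingCode_lineGraph :
    ApproximableInPolyTime 4 (fun _ G => IsLineGraph G) outputVertices
      (fun _ G C => IsIdentifyingCode G C) := by
  obtain ⟨T, hT⟩ := greedyProg_correct (scan := fun p => .loop 1 p)
    (ad := .var 1) (valid := .const 1) (code := .vertexCode) (M := fun n => n)
    (S := fun n _ => {a | a < n}) (P := fun n G A => IsIdentifyingCode G {v | (v : ℕ) ∈ A})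
    (by simp [RAMStmt.Scoped, RAMTerm.Scoped, markStmt, deleteStmt, RAMTerm.addr,
          RAMTerm.vertexCode, RAMTerm.and, RAMTerm.all, RAMTerm.neg, RAMTerm.closedAdj, RAMTerm.xor,
          RAMTerm.eq, RAMTerm.ne])
    (by simp [RAMTerm.Scoped, RAMTerm.addr, RAMTerm.vertexCode, RAMTerm.and, RAMTerm.all,
          RAMTerm.neg, RAMTerm.closedAdj, RAMTerm.xor, RAMTerm.eq, RAMTerm.ne])
    (by
      intro p n ρ β I hρ h0 hI
      refine RAMStmt.run_loop_induction hρ I h0 fun i hi γ hγ => ?_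
      refine hI i hi _ (by simpa using hρ) (fun γ => ?_) γ hγ
      simp [RAMTerm.eval])
    (fun n G a ha => ha)
    (fun n G A B hAB hB hA => hA.mono fun v hv => hAB hv)
    (fun n G ρ m γ hρ had hm hγ => iff_of_true one_ne_zero hm)
    (fun n G ρ γ hρ hγ hS => holds_vertexCode hρ hγ)
  refine ⟨greedyProg (fun p => .loop 1 p) (.var 1) (.const 1) .vertexCode, T, fun n G => ?_⟩
  obtain ⟨t, s, hexec, ht, hsub, hreg, hfeas, hmin⟩ := hT n G
  refine ⟨t, s, hexec, ht, fun hG => ⟨hreg.trans ⟨fun h => ⟨_, h⟩, fun ⟨C, hC⟩ => hfeas ?_⟩,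
    fun h => ⟨hreg.1 h, fun D hD => ncard_le_four_mul_of_isLineGraph hG (hreg.1 h) ?_ hD⟩⟩⟩
  · exact hC.mono fun v _ => v.2
  · intro v hv hD
    exact hmin v hv (hD.mono fun w hw => ⟨hw.1, fun h => hw.2 (Fin.ext h)⟩)

/-! ### The approximation theorem -/

theorem theorem5p6 :
    -- EDGE-IDCODE in general graphs
    ApproximableInPolyTime 4 (fun _ _ => True) outputPairs
      (fun _ G C => IsEdgeIdentifyingCode G C) ∧
    -- IDCODE restricted to line graphs
    ApproximableInPolyTime 4 (fun _ G => IsLineGraph G) outputVertices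
      (fun _ G C => IsIdentifyingCode G C) ∧
    -- bounds for inclusionwise minimal edge-identifying codes
    (∀ (V : Type*) [Fintype V] (G : SimpleGraph V) (C : Set (Sym2 V)),
      G.edgeSet.Nonempty → Minimal (IsEdgeIdentifyingCode G) C →
        (C.ncard : ℝ) ≤ 2 * (Fintype.card V : ℝ) - 3 ∧
        ((∀ v, ∃ w, G.Adj v w) → (Fintype.card V : ℝ) / 2 ≤ (C.ncard : ℝ))) := by
  refine ⟨approximable_edgeIdentifyingCode, approximable_identifyingCode_lineGraph, ?_⟩
  intro V _ G C hE hC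
  constructor
  · have h1 := ncard_add_three_le_of_minimal hE hC.prop fun c hc h =>
      (hC.le_of_le h Set.sdiff_subset hc).2 rfl
    have h2 : G.support.ncard ≤ Fintype.card V := by
      rw [← Nat.card_eq_fintype_card]; exact Set.ncard_le_card _
    have h3 : C.ncard + 3 ≤ 2 * Fintype.card V := by omega
    have h4 : (C.ncard : ℝ) + 3 ≤ 2 * (Fintype.card V : ℝ) := by exact_mod_cast h3
    linarith
  · intro hiso
    have h1 := support_ncard_le_two_mul hC.prop
    rw [show G.support = Set.univ from Set.eq_univ_of_forall hiso, Set.ncard_univ,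
      Nat.card_eq_fintype_card] at h1
    have h2 : (Fintype.card V : ℝ) ≤ 2 * (C.ncard : ℝ) := by exact_mod_cast h1
    linarith
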